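/- Let $(K,d)$ be a countable compact metric space with a distinguished point $0\in K$. Let $Lip_0(K)$ be the space of Lipschitz functions $f:K\to\mathbb{R}$ with $f(0)=0$, with the norm $\|f\|_L=\sup_{x\neq y}\frac{|f(x)-f(y)|}{d(x,y)}$, and let $lip_0(K)\subset Lip_0(K)$ be the subspace, with the same norm, of all $f$ such that for every $\varepsilon>0$ there is a $\delta>0$ such that $|f(x)-f(y)|\le\varepsilon\, d(x,y)$ for all $x,y\in K$ with $d(x,y)<\delta$. Let the Lipschitz-free space $\mathcal{F}(K)$ be the closed linear span in the dual space $Lip_0(K)^*$ of the evaluations $\delta_x:f\mapsto f(x)$, $x\in K$. Then $\mathcal{F}(K)$ is isometrically isomorphic to a dual space, namely to $lip_0(K)^*$: there is a surjective linear isometry from $\mathcal{F}(K)$ onto $lip_0(K)^*$. -/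

import Mathlib

open scoped NNReal

noncomputable section

namespace LipFree

variable {M : Type*} [MetricSpace M]

/-- The real vector space of Lipschitz functions `M → ℝ` vanishing at the origin `o`. -/
def lipZeroSubmodule (o : M) : Submodule ℝ (M → ℝ) where
  carrier := {f | f o = 0 ∧ ∃ C : ℝ≥0, LipschitzWith C f}
  zero_mem' := ⟨rfl, 0, LipschitzWith.const 0⟩
  add_mem' := by
    rintro f g ⟨hf, C, hC⟩ ⟨hg, D, hD⟩
    exact ⟨by simp [hf, hg], C + D, hC.add hD⟩
  smul_mem' := by
    rintro c f ⟨hf, C, hC⟩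
    exact ⟨by simp [hf], ‖c‖₊ * C, (lipschitzWith_smul c).comp hC⟩

/-- `Lip₀(M)`, for the metric space `M` with origin `o`. It is a separate type, so that it carries
the topology of the Lipschitz norm and not the one of pointwise convergence. -/
def LipZero (o : M) : Type _ := lipZeroSubmodule o

variable {o : M}

instance : AddCommGroup (LipZero o) := inferInstanceAs (AddCommGroup (lipZeroSubmodule o))

instance : Module ℝ (LipZero o) := inferInstanceAs (Module ℝ (lipZeroSubmodule o))

instance : FunLike (LipZero o) M ℝ where
  coe f := f.1
  coe_injective := Subtype.coe_injective

namespace LipZero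

theorem coe_add (f g : LipZero o) (x : M) : (f + g) x = f x + g x := rfl

theorem coe_smul (c : ℝ) (f : LipZero o) (x : M) : (c • f) x = c * f x := rfl

theorem coe_zero (x : M) : (0 : LipZero o) x = 0 := rfl

theorem coe_neg (f : LipZero o) (x : M) : (-f) x = -f x := rfl

theorem map_origin (f : LipZero o) : f o = 0 := f.2.1

theorem exists_lipschitz (f : LipZero o) : ∃ C : ℝ≥0, LipschitzWith C f := f.2.2

/-- The Lipschitz norm: the supremum of `|f x - f y| / d(x, y)` over all pairs `x ≠ y`
(equal to `0` if there is no such pair). -/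
instance : Norm (LipZero o) where
  norm f := ⨆ p : {p : M × M // p.1 ≠ p.2}, |f p.1.1 - f p.1.2| / dist p.1.1 p.1.2

theorem norm_def (f : LipZero o) :
    ‖f‖ = ⨆ p : {p : M × M // p.1 ≠ p.2}, |f p.1.1 - f p.1.2| / dist p.1.1 p.1.2 := rfl

theorem bddAbove_slopes (f : LipZero o) : BddAbove (Set.range
    fun p : {p : M × M // p.1 ≠ p.2} => |f p.1.1 - f p.1.2| / dist p.1.1 p.1.2) := by
  obtain ⟨C, hC⟩ := f.exists_lipschitz
  refine ⟨C, ?_⟩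
  rintro _ ⟨p, rfl⟩
  refine div_le_of_le_mul₀ dist_nonneg C.2 ?_
  simpa [Real.dist_eq] using hC.dist_le_mul p.1.1 p.1.2

theorem norm_nonneg' (f : LipZero o) : 0 ≤ ‖f‖ :=
  Real.iSup_nonneg fun _ => div_nonneg (abs_nonneg _) dist_nonneg

theorem abs_sub_le (f : LipZero o) (x y : M) : |f x - f y| ≤ ‖f‖ * dist x y := by
  by_cases h : x = y
  · simp [h]
  · rw [← div_le_iff₀ (dist_pos.2 h)]
    exact le_ciSup (bddAbove_slopes f) ⟨(x, y), h⟩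

theorem norm_le_of_abs_sub_le (f : LipZero o) {C : ℝ} (hC : 0 ≤ C)
    (h : ∀ x y, |f x - f y| ≤ C * dist x y) : ‖f‖ ≤ C :=
  Real.iSup_le (fun _ => div_le_of_le_mul₀ dist_nonneg hC (h _ _)) hC

theorem abs_le (f : LipZero o) (x : M) : |f x| ≤ ‖f‖ * dist x o := by
  simpa [map_origin] using f.abs_sub_le x o

theorem normCore : NormedSpace.Core ℝ (LipZero o) where
  norm_nonneg := norm_nonneg'
  norm_smul c f := by
    rw [norm_def, norm_def, Real.norm_eq_abs, Real.mul_iSup_of_nonneg (abs_nonneg c)]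
    refine iSup_congr fun p => ?_
    rw [coe_smul, coe_smul, ← mul_sub, abs_mul, mul_div_assoc]
  norm_triangle f g := by
    refine norm_le_of_abs_sub_le _ (add_nonneg (norm_nonneg' f) (norm_nonneg' g)) fun x y => ?_
    rw [coe_add, coe_add, add_sub_add_comm, add_mul]
    exact (abs_add_le _ _).trans (add_le_add (f.abs_sub_le x y) (g.abs_sub_le x y))
  norm_eq_zero_iff f := by
    refine ⟨fun h => DFunLike.ext _ _ fun x => ?_, ?_⟩
    · have := f.abs_le x
      rw [h, zero_mul] at this
      exact abs_nonpos_iff.1 this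
    · rintro rfl
      exact le_antisymm (norm_le_of_abs_sub_le _ le_rfl (by simp [coe_zero])) (norm_nonneg' _)

instance : NormedAddCommGroup (LipZero o) := NormedAddCommGroup.ofCore normCore

instance : NormedSpace ℝ (LipZero o) := NormedSpace.ofCore normCore

end LipZero

variable (o)

/-- The evaluation functional `δ_x : f ↦ f x` in `Lip₀(M)^*`. -/
def delta (x : M) : StrongDual ℝ (LipZero o) :=
  LinearMap.mkContinuous
    { toFun := fun f => f x
      map_add' := fun _ _ => rfl
      map_smul' := fun _ _ => rfl }
    (dist x o) fun f => by
      rw [mul_comm]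
      exact f.abs_le x

/-- The Lipschitz-free space `F(M)`: the closed linear span of the evaluations `δ_x`, `x ∈ M`,
in `Lip₀(M)^*` (with the dual norm). -/
def FreeSpace : Submodule ℝ (StrongDual ℝ (LipZero o)) :=
  (Submodule.span ℝ (Set.range (delta o))).topologicalClosure

/-- The little Lipschitz space `lip₀(M)`, a subspace of `Lip₀(M)` with the Lipschitz norm. -/
def LittleLipZero : Submodule ℝ (LipZero o) where
  carrier := {f | ∀ ε : ℝ, 0 < ε → ∃ δ : ℝ, 0 < δ ∧
    ∀ x y : M, dist x y < δ → |f x - f y| ≤ ε * dist x y}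
  zero_mem' := fun ε hε => ⟨1, one_pos, fun x y _ => by
    simpa [LipZero.coe_zero] using mul_nonneg hε.le dist_nonneg⟩
  add_mem' := by
    intro f g hf hg ε hε
    obtain ⟨δ₁, h₁, hf⟩ := hf (ε / 2) (half_pos hε)
    obtain ⟨δ₂, h₂, hg⟩ := hg (ε / 2) (half_pos hε)
    refine ⟨min δ₁ δ₂, lt_min h₁ h₂, fun x y h => ?_⟩
    rw [LipZero.coe_add, LipZero.coe_add, add_sub_add_comm]
    have h1 := hf x y (h.trans_le (min_le_left _ _))
    have h2 := hg x y (h.trans_le (min_le_right _ _))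
    have h3 := abs_add_le (f x - f y) (g x - g y)
    linarith
  smul_mem' := by
    intro c f hf ε hε
    have hc : 0 < |c| + 1 := by positivity
    obtain ⟨δ, hδ, hf⟩ := hf (ε / (|c| + 1)) (div_pos hε hc)
    refine ⟨δ, hδ, fun x y h => ?_⟩
    rw [LipZero.coe_smul, LipZero.coe_smul, ← mul_sub, abs_mul]
    calc |c| * |f x - f y| ≤ (|c| + 1) * (ε / (|c| + 1) * dist x y) :=
          mul_le_mul (by linarith) (hf x y h) (abs_nonneg _) hc.le
      _ = ε * dist x y := by field_simp

end LipFree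

end

open MeasureTheory Filter Topology Set

/-! The isometry is restriction of functionals to `lip₀(K)`. It preserves norms because `f(K)` is
countable, hence null: composing `f` with a 1-Lipschitz near-identity that is locally constant
around `f(K)` approximates `f` by little Lipschitz functions of no larger norm
(`exists_littleLip_approx`), and elements of `F(K)` respect bounded pointwise limits
(`FreeSpace.tendsto_apply`). It is onto because slopes embed `lip₀(K)` in `C(K × K)`, where
Hahn–Banach and Riesz turn a functional into a finite measure. As `K × K` is countable, the
molecules have a Bochner integral against it inside `F(K)`, and this is the preimage. -/

theorem exists_measure_eq_integral_of_le_mul_iSup {X V : Type*} [TopologicalSpace X] [T2Space X]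
    [CompactSpace X] [Nonempty X] [MeasurableSpace X] [BorelSpace X] [AddCommGroup V] [Module ℝ V]
    (Φ : V →ₗ[ℝ] C(X, ℝ)) (hΦ : Function.Injective Φ) (φ : V →ₗ[ℝ] ℝ) {c : ℝ} (hc : 0 ≤ c)
    (hφ : ∀ v, φ v ≤ c * ⨆ x, Φ v x) :
    ∃ μ : Measure X, IsFiniteMeasure μ ∧ ∀ v, φ v = ∫ x, Φ v x ∂μ := by
  have hbdd (g : C(X, ℝ)) : BddAbove (range g) := (isCompact_range g.continuous).bddAbove
  let e := LinearEquiv.ofInjective Φ hΦ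
  -- Dominating by the one-sided supremum instead of the norm forces the extension to be positive,
  -- so Riesz yields a positive measure.
  obtain ⟨Λ, hΛ, hΛN⟩ := exists_extension_of_le_sublinear
    (⟨LinearMap.range Φ, φ ∘ₗ e.symm.toLinearMap⟩ : C(X, ℝ) →ₗ.[ℝ] ℝ)
    (fun g => c * ⨆ x, g x)
    (fun a ha g => by
      simp only [ContinuousMap.smul_apply, smul_eq_mul]
      rw [← Real.mul_iSup_of_nonneg ha.le]
      ring)
    (fun f g => by
      rw [← mul_add]
      refine mul_le_mul_of_nonneg_left (ciSup_le fun x => ?_) hc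
      exact add_le_add (le_ciSup (hbdd f) x) (le_ciSup (hbdd g) x))
    (by
      rintro ⟨_, v, rfl⟩
      have : e.symm ⟨Φ v, v, rfl⟩ = v := e.symm_apply_apply v
      simpa [this] using hφ v)
  have hpos (g : C(X, ℝ)) (hg : 0 ≤ g) : 0 ≤ Λ g := by
    have h := hΛN (-g)
    rw [map_neg] at h
    have : c * ⨆ x, (-g) x ≤ 0 :=
      mul_nonpos_of_nonneg_of_nonpos hc (ciSup_le fun x => neg_nonpos.2 (hg x))
    linarith
  let Λc : CompactlySupportedContinuousMap X ℝ →ₚ[ℝ] ℝ := PositiveLinearMap.mk₀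
    { toFun := fun g => Λ g.toContinuousMap
      map_add' := fun f g => Λ.map_add f.toContinuousMap g.toContinuousMap
      map_smul' := fun a g => Λ.map_smul a g.toContinuousMap }
    (fun g hg => hpos _ hg)
  refine ⟨RealRMK.rieszMeasure Λc, inferInstance, fun v => ?_⟩
  have h := RealRMK.integral_rieszMeasure Λc
    (CompactlySupportedContinuousMap.continuousMapEquiv (Φ v))
  refine Eq.trans ?_ h.symm
  have h2 := hΛ ⟨Φ v, v, rfl⟩
  have : e.symm ⟨Φ v, v, rfl⟩ = v := e.symm_apply_apply v
  refine Eq.trans ?_ h2.symm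
  simp [this]

/-- A countable compact subset of the line has a `1`-Lipschitz perturbation of the identity that is
locally constant near it, uniformly in the distance. -/
theorem exists_lipschitz_locally_constant_near {S : Set ℝ} (hS : S.Countable) (hS' : IsCompact S)
    {ε : ℝ} (hε : 0 < ε) :
    ∃ h : ℝ → ℝ, h 0 = 0 ∧ (∀ s t, |h s - h t| ≤ |s - t|) ∧ (∀ t, |h t - t| ≤ ε) ∧
      ∃ δ > 0, ∀ s ∈ S, ∀ t, |s - t| < δ → h s = h t := by
  -- `h` will be the primitive of the indicator of `Uᶜ`: flat along intervals in `U`, and off the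
  -- identity by at most the measure of `U`.
  obtain ⟨U, hSU, hU, hUε⟩ := S.exists_isOpen_lt_of_lt (μ := volume) (ENNReal.ofReal ε)
    (by rw [hS.measure_zero]; exact ENNReal.ofReal_pos.2 hε)
  let i : ℝ → ℝ := Uᶜ.indicator 1
  have hi (a b : ℝ) : IntervalIntegrable i volume a b := by
    rw [intervalIntegrable_iff]
    exact (integrableOn_const (by simp)).indicator hU.measurableSet.compl
  have hsub (s t : ℝ) : (∫ x in (0 : ℝ)..s, i x) - ∫ x in (0 : ℝ)..t, i x = ∫ x in t..s, i x :=
    intervalIntegral.integral_interval_sub_left (hi _ _) (hi _ _)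
  refine ⟨fun t => ∫ x in (0 : ℝ)..t, i x, intervalIntegral.integral_same, fun s t => ?_,
    fun t => ?_, ?_⟩
  · rw [hsub]
    have := intervalIntegral.norm_integral_le_of_norm_le_const (a := t) (b := s) (f := i) (C := 1)
      (fun x _ => by by_cases hx : x ∈ U <;> simp [i, hx])
    simpa using this
  · have h1 : (∫ x in (0 : ℝ)..t, i x) - t = - ∫ x in (0 : ℝ)..t, U.indicator 1 x := by
      have : IntervalIntegrable (U.indicator (1 : ℝ → ℝ)) volume 0 t := by
        rw [intervalIntegrable_iff]
        exact (integrableOn_const (by simp)).indicator hU.measurableSet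
      have h2 := intervalIntegral.integral_add (hi 0 t) this
      have h3 : ∀ x, i x + U.indicator 1 x = 1 := fun x => by by_cases hx : x ∈ U <;> simp [i, hx]
      simp only [h3, intervalIntegral.integral_const, sub_zero, smul_eq_mul, mul_one] at h2
      linarith
    rw [h1, abs_neg, ← Real.norm_eq_abs]
    refine intervalIntegral.norm_integral_le_integral_norm_uIoc.trans ?_
    have h4 : ∀ x, ‖U.indicator (1 : ℝ → ℝ) x‖ = U.indicator 1 x := fun x => by
      by_cases hx : x ∈ U <;> simp [hx]
    simp only [h4]
    rw [integral_indicator_one hU.measurableSet]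
    refine ENNReal.toReal_le_of_le_ofReal hε.le ?_
    exact (Measure.restrict_apply_le _ _).trans hUε.le
  · obtain ⟨δ, hδ, hSδ⟩ := hS'.exists_thickening_subset_open hU hSU
    refine ⟨δ, hδ, fun s hs t hst => sub_eq_zero.1 ?_⟩
    rw [hsub]
    refine intervalIntegral.integral_zero_ae (ae_of_all _ fun x hx => ?_)
    have hxU : x ∈ U := hSδ (Metric.mem_thickening_iff.2 ⟨s, hs, by
      rw [Real.dist_eq]
      have := abs_sub_right_of_mem_uIcc (uIoc_subset_uIcc hx)
      have := abs_sub_left_of_mem_uIcc (uIoc_subset_uIcc hx)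
      rw [abs_sub_comm] at hst
      grind⟩)
    simp [i, hxU]

/-- A bounded map from a countable space to a closed subspace has its barycentre there. -/
theorem Submodule.exists_mem_forall_apply_eq_integral {X E : Type*} [MeasurableSpace X]
    [DiscreteMeasurableSpace X] [Countable X] [NormedAddCommGroup E] [NormedSpace ℝ E]
    [CompleteSpace E] {S : Submodule ℝ E} (hS : IsClosed (S : Set E)) (μ : Measure X)
    [IsFiniteMeasure μ] {v : X → E} (hv : ∀ x, v x ∈ S) {C : ℝ} (hC : ∀ x, ‖v x‖ ≤ C) :
    ∃ m ∈ S, ∀ L : E →L[ℝ] ℝ, L m = ∫ x, L (v x) ∂μ := by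
  -- Integrating in `S` itself, not in `E`, makes membership automatic.
  have : CompleteSpace S := hS.completeSpace_coe
  have hint : Integrable (fun x => (⟨v x, hv x⟩ : S)) μ :=
    Integrable.of_bound StronglyMeasurable.of_discrete.aestronglyMeasurable C (ae_of_all _ hC)
  exact ⟨_, (∫ x, (⟨v x, hv x⟩ : S) ∂μ).2,
    fun L => ((L.comp S.subtypeL).integral_comp_comm hint).symm⟩

namespace LipFree

variable {K : Type*} [MetricSpace K] {o : K}

namespace LipZero

theorem exists_littleLip_approx [CompactSpace K] [Countable K] (f : LipZero o) {ε : ℝ}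
    (hε : 0 < ε) : ∃ g ∈ LittleLipZero o, ‖g‖ ≤ ‖f‖ ∧ ∀ x, |g x - f x| ≤ ε := by
  obtain ⟨C, hC⟩ := f.exists_lipschitz
  obtain ⟨h, h0, hlip, happrox, δ, hδ, hconst⟩ := exists_lipschitz_locally_constant_near
    (countable_range f) (isCompact_range hC.continuous) hε
  have hlip' (x y : K) : |h (f x) - h (f y)| ≤ ‖f‖ * dist x y :=
    (hlip _ _).trans (f.abs_sub_le x y)
  let g : LipZero o := ⟨fun x => h (f x), by simp only [f.map_origin, h0], ‖f‖₊,
    LipschitzWith.of_dist_le_mul hlip'⟩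
  refine ⟨g, fun η hη => ⟨δ / (‖f‖ + 1), by positivity, fun x y hxy => ?_⟩,
    norm_le_of_abs_sub_le _ (norm_nonneg _) hlip', fun x => happrox _⟩
  have : g x = g y := by
    refine hconst _ ⟨x, rfl⟩ _ ((f.abs_sub_le x y).trans_lt ?_)
    rw [lt_div_iff₀ (by positivity)] at hxy
    nlinarith [dist_nonneg (x := x) (y := y)]
  rw [this, sub_self, abs_zero]
  positivity

theorem exists_seq_littleLip_tendsto [CompactSpace K] [Countable K] (f : LipZero o) :
    ∃ g : ℕ → LittleLipZero o, (∀ n, ‖g n‖ ≤ ‖f‖) ∧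
      ∀ x, Tendsto (fun n => (g n : LipZero o) x) atTop (𝓝 (f x)) := by
  choose g hg hgf happrox using fun n : ℕ =>
    f.exists_littleLip_approx (ε := 1 / ((n : ℝ) + 1)) (by positivity)
  exact ⟨fun n => ⟨g n, hg n⟩, hgf, fun x => tendsto_iff_dist_tendsto_zero.2 <|
    squeeze_zero (fun _ => dist_nonneg) (fun n => happrox n x)
      tendsto_one_div_add_atTop_nhds_zero_nat⟩

end LipZero

theorem delta_mem_freeSpace (x : K) : delta o x ∈ FreeSpace o :=
  Submodule.le_topologicalClosure _ (Submodule.subset_span ⟨x, rfl⟩)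

/-- Evaluations converge by hypothesis, hence so does their span; the uniform norm bound carries
this to the closure by an `ε / 3` argument. -/
theorem FreeSpace.tendsto_apply {m : StrongDual ℝ (LipZero o)} (hm : m ∈ FreeSpace o)
    {g : ℕ → LipZero o} {f : LipZero o} {C : ℝ} (hC : ∀ n, ‖g n‖ ≤ C)
    (hg : ∀ x, Tendsto (fun n => g n x) atTop (𝓝 (f x))) :
    Tendsto (fun n => m (g n)) atTop (𝓝 (m f)) := by
  have hspan : ∀ m ∈ Submodule.span ℝ (range (delta o)),
      Tendsto (fun n => m (g n)) atTop (𝓝 (m f)) := by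
    intro m hm
    induction hm using Submodule.span_induction with
    | mem m hm => obtain ⟨x, rfl⟩ := hm; exact hg x
    | zero => exact tendsto_const_nhds
    | add m m' _ _ h h' => exact h.add h'
    | smul a m _ h => exact h.const_mul a
  have hC0 : 0 ≤ C := (norm_nonneg _).trans (hC 0)
  rw [Metric.tendsto_atTop]
  intro ε hε
  let D := C + ‖f‖ + 1
  have hD : 0 < D := by positivity
  obtain ⟨m', hm', hmm'⟩ := Metric.mem_closure_iff.1 hm (ε / (3 * D)) (by positivity)
  obtain ⟨N, hN⟩ := Metric.tendsto_atTop.1 (hspan m' hm') (ε / 3) (by positivity)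
  have hclose (k : LipZero o) (hk : ‖k‖ ≤ D) : dist (m k) (m' k) ≤ ε / 3 := by
    rw [dist_eq_norm, ← sub_apply]
    refine ((m - m').le_opNorm k).trans ?_
    rw [dist_eq_norm] at hmm'
    calc ‖m - m'‖ * ‖k‖ ≤ ε / (3 * D) * D := by gcongr
      _ = ε / 3 := by field_simp
  refine ⟨N, fun n hn => ?_⟩
  have h1 := hclose (g n) (by have := hC n; have := norm_nonneg f; simp only [D]; linarith)
  have h2 := hclose f (by simp only [D]; linarith)
  have h3 := hN n hn
  have h4 := dist_triangle4 (m (g n)) (m' (g n)) (m' f) (m f)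
  rw [dist_comm (m' f)] at h4
  linarith

variable (o) in
/-- The restriction of functionals in `F(K)` to `lip₀(K)`, an isometry for countable compact `K`. -/
noncomputable def FreeSpace.restrictLittleLip [CompactSpace K] [Countable K] :
    FreeSpace o →ₗᵢ[ℝ] StrongDual ℝ (LittleLipZero o) where
  toFun m := (m : StrongDual ℝ (LipZero o)).comp (LittleLipZero o).subtypeL
  map_add' _ _ := rfl
  map_smul' _ _ := rfl
  norm_map' m := by
    refine le_antisymm ?_ ?_
    · exact ContinuousLinearMap.opNorm_le_bound _ (norm_nonneg m.1) fun f => m.1.le_opNorm f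
    · refine ContinuousLinearMap.opNorm_le_bound m.1
        (norm_nonneg (m.1.comp (LittleLipZero o).subtypeL)) fun f => ?_
      obtain ⟨g, hgf, hg⟩ := f.exists_seq_littleLip_tendsto
      refine le_of_tendsto' (FreeSpace.tendsto_apply m.2 (g := fun n => g n) hgf hg).norm
        fun n => ?_
      exact (ContinuousLinearMap.le_opNorm
        ((m : StrongDual ℝ (LipZero o)).comp (LittleLipZero o).subtypeL) (g n)).trans
        (mul_le_mul_of_nonneg_left (hgf n) (ContinuousLinearMap.opNorm_nonneg _))

/-- The molecule `(δ_x - δ_y) / d(x, y)`, equal to `0` on the diagonal. -/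
noncomputable def molecule (o : K) (p : K × K) : FreeSpace o :=
  (dist p.1 p.2)⁻¹ • (⟨delta o p.1, delta_mem_freeSpace _⟩ - ⟨delta o p.2, delta_mem_freeSpace _⟩)

theorem molecule_apply (p : K × K) (f : LipZero o) :
    (molecule o p : StrongDual ℝ (LipZero o)) f = (f p.1 - f p.2) / dist p.1 p.2 :=
  inv_mul_eq_div _ _

theorem norm_molecule_le (p : K × K) : ‖molecule o p‖ ≤ 1 := by
  refine ContinuousLinearMap.opNorm_le_bound (molecule o p).1 zero_le_one fun f => ?_
  rw [molecule_apply, norm_div, Real.norm_eq_abs, Real.norm_of_nonneg dist_nonneg, one_mul]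
  exact div_le_of_le_mul₀ dist_nonneg (norm_nonneg _) (f.abs_sub_le _ _)

namespace LittleLipZero

/-- The little Lipschitz condition is what gives continuity at the diagonal, where division by zero
supplies the limit value `0`. -/
theorem continuous_slope (f : LittleLipZero o) :
    Continuous fun p : K × K => ((f : LipZero o) p.1 - (f : LipZero o) p.2) / dist p.1 p.2 := by
  obtain ⟨C, hC⟩ := (f : LipZero o).exists_lipschitz
  have hcont := hC.continuous
  refine continuous_iff_continuousAt.2 fun p => ?_
  by_cases hp : p.1 = p.2
  · rw [Metric.continuousAt_iff]
    intro ε hε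
    obtain ⟨δ, hδ, hf⟩ := f.2 (ε / 2) (by positivity)
    have hd : ContinuousAt (fun q : K × K => dist q.1 q.2) p := by fun_prop
    obtain ⟨η, hη, h⟩ := Metric.continuousAt_iff.1 hd δ hδ
    refine ⟨η, hη, fun q hq => ?_⟩
    have hq' := h hq
    rw [hp, dist_self, Real.dist_0_eq_abs, abs_of_nonneg dist_nonneg] at hq'
    rw [hp, dist_self, div_zero, Real.dist_0_eq_abs, abs_div,
      abs_of_nonneg (dist_nonneg (x := q.1))]
    exact (div_le_of_le_mul₀ dist_nonneg (by positivity) (hf _ _ hq')).trans_lt (by linarith)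
  · exact ContinuousAt.div (by fun_prop) (by fun_prop) (dist_ne_zero.2 hp)

variable (o) in
/-- The de Leeuw embedding of `lip₀(K)` into `C(K × K)`, sending `f` to its slopes (and `0` on the
diagonal). -/
noncomputable def slope : LittleLipZero o →ₗ[ℝ] C(K × K, ℝ) where
  toFun f := ⟨_, continuous_slope f⟩
  map_add' f g := by
    ext p
    simp only [ContinuousMap.coe_mk, ContinuousMap.add_apply, Submodule.coe_add, LipZero.coe_add]
    ring
  map_smul' c f := by
    ext p
    simp only [ContinuousMap.coe_mk, ContinuousMap.smul_apply, Submodule.coe_smul,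
      LipZero.coe_smul, RingHom.id_apply, smul_eq_mul]
    ring

theorem slope_apply (f : LittleLipZero o) (p : K × K) :
    slope o f p = ((f : LipZero o) p.1 - (f : LipZero o) p.2) / dist p.1 p.2 := rfl

/-- Swapping the two points changes the sign of the slope, so no absolute value is needed in the
supremum. -/
theorem norm_le_iSup_slope [CompactSpace K] (f : LittleLipZero o) : ‖f‖ ≤ ⨆ p, slope o f p := by
  have hle (p : K × K) : slope o f p ≤ ⨆ p, slope o f p :=
    le_ciSup (isCompact_range (slope o f).continuous).bddAbove p
  refine LipZero.norm_le_of_abs_sub_le _ ?_ fun x y => ?_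
  -- The diagonal value `0` makes the supremum nonnegative.
  · simpa [slope_apply] using hle (o, o)
  · rcases eq_or_ne x y with rfl | hxy
    · simp
    have hd := dist_pos.2 hxy
    have h1 := hle (x, y)
    have h2 := hle (y, x)
    rw [slope_apply, div_le_iff₀ (by simpa using hd)] at h1
    rw [slope_apply, div_le_iff₀ (by simpa [dist_comm] using hd), dist_comm] at h2
    exact abs_sub_le_iff.2 ⟨h1, h2⟩

theorem slope_injective [CompactSpace K] : Function.Injective (slope o) := by
  refine (injective_iff_map_eq_zero _).2 fun f hf => norm_le_zero_iff.1 ?_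
  simpa [hf] using norm_le_iSup_slope f

end LittleLipZero

theorem FreeSpace.restrictLittleLip_surjective [CompactSpace K] [Countable K] :
    Function.Surjective (restrictLittleLip o) := by
  intro φ
  have : Nonempty K := ⟨o⟩
  let _ : MeasurableSpace (K × K) := borel _
  have : BorelSpace (K × K) := ⟨rfl⟩
  obtain ⟨μ, hμ, hφ⟩ := exists_measure_eq_integral_of_le_mul_iSup (LittleLipZero.slope o)
    LittleLipZero.slope_injective φ.toLinearMap φ.opNorm_nonneg fun f =>
      (le_abs_self _).trans <| (φ.le_opNorm f).trans <|
        mul_le_mul_of_nonneg_left (LittleLipZero.norm_le_iSup_slope f) φ.opNorm_nonneg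
  obtain ⟨m, hm, hmint⟩ := Submodule.exists_mem_forall_apply_eq_integral
    (S := FreeSpace o) (Submodule.isClosed_topologicalClosure _) μ
    (fun p => (molecule o p).2) norm_molecule_le
  refine ⟨⟨m, hm⟩, ContinuousLinearMap.ext fun f => ?_⟩
  -- Evaluation at `f` is continuous on the dual, so it commutes with the barycentre and turns
  -- molecules into slopes of `f`.
  refine (hmint (ContinuousLinearMap.apply ℝ ℝ (f : LipZero o))).trans
    (Eq.trans ?_ (hφ f).symm)
  exact integral_congr_ae (ae_of_all _ fun p => molecule_apply p (f : LipZero o))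

end LipFree

theorem theorem2p1 {K : Type*} [MetricSpace K] [CompactSpace K] [Countable K] (o : K) :
    Nonempty (LipFree.FreeSpace o ≃ₗᵢ[ℝ] StrongDual ℝ (LipFree.LittleLipZero o)) :=
  ⟨{ LinearEquiv.ofBijective (LipFree.FreeSpace.restrictLittleLip o).toLinearMap
      ⟨fun _ _ h => (LipFree.FreeSpace.restrictLittleLip o).injective h,
        LipFree.FreeSpace.restrictLittleLip_surjective⟩ with
    norm_map' := (LipFree.FreeSpace.restrictLittleLip o).norm_map }⟩
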